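/- Let $T=(t_{ij})\in\mathbb{R}^{n\times n}$ be the transition matrix of an ergodic homogeneous Markov chain $X_0,X_1,\dots$ with states $1,\dots,n$; that is, $T$ is an irreducible (row-)stochastic matrix. For states $i,j$, let $F_j=\min\{p\ge 1 : X_p=j\}$ and let $m_{ij}=\mathrm{E}(F_j\mid X_0=i)$ be the mean first passage time from $i$ to $j$. Let $G$ be the loopless weighted digraph with vertices $1,\dots,n$ that has an arc $(i,j)$ of weight $t_{ij}$ whenever $i\ne j$ and $t_{ij}\ne 0$. A converging tree is a weakly connected digraph in which one vertex, the root, has outdegree zero and every other vertex has outdegree one; it is said to converge to its root. An in-forest of $G$ is a spanning subgraph of $G$ all of whose weak components are converging trees. The weight of a subgraph is the product of its arc weights (equal to $1$ if it has no arcs), and the total weight of a set of subgraphs is the sum of their weights. Let $q_j$ be the total weight of the spanning trees of $G$ that converge to $j$, and let $\tilde q_j=q_j/\sum_{k=1}^n q_k$. For $i\neq j$, let $f_{ij}$ be the total weight of the in-forests of $G$ that consist of exactly two trees, one containing $i$ and the other converging to $j$. Then, for all states $i,j$, we have $q_j>0$, the mean first passage time $m_{ij}$ is finite, and $$ m_{ij}=\begin{cases}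 f_{ij}/q_j, & i\ne j,\\ 1/\tilde q_j, & i=j.\end{cases} $$ -/

import Mathlib

open MeasureTheory ProbabilityTheory
open scoped ENNReal

namespace MFPT

/-! ### Homogeneous Markov chains and mean first passage times -/

section Chain

variable {V Ω : Type*} [MeasurableSpace V] [MeasurableSpace Ω]

/-- `X 0, X 1, …` is a homogeneous Markov chain on the state space `V` with transition matrix `T`
under the probability measure `μ` (with an arbitrary initial distribution):
`Pr(X 0 = x 0, …, X (p+1) = x (p+1)) = Pr(X 0 = x 0, …, X p = x p) * T (x p) (x (p+1))`,
that is, `Pr(X (p+1) = y | X 0 = x 0, …, X p = x p) = T (x p) y` whenever the conditioning event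
has positive probability. -/
structure IsMarkovChain (T : Matrix V V ℝ) (μ : Measure Ω) (X : ℕ → Ω → V) : Prop where
  measurable : ∀ p, Measurable (X p)
  markov : ∀ (p : ℕ) (x : ℕ → V),
    μ {ω | ∀ k ≤ p + 1, X k ω = x k} =
      μ {ω | ∀ k ≤ p, X k ω = x k} * ENNReal.ofReal (T (x p) (x (p + 1)))

/-- The first passage time `min {p ≥ 1 : X p = j}`, equal to `⊤` if `j` is never reached at a
positive time. -/
noncomputable def firstPassageTime (X : ℕ → Ω → V) (j : V) (ω : Ω) : ℕ∞ :=
  hittingAfter X {j} 1 ω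

/-- The mean first passage time from `i` to `j`: the expectation, conditional on `X 0 = i`, of the
first passage time to `j` (as an extended nonnegative real, so that no finiteness is presupposed). -/
noncomputable def meanFirstPassageTime (μ : Measure Ω) (X : ℕ → Ω → V) (i j : V) : ℝ≥0∞ :=
  ∫⁻ ω, (firstPassageTime X j ω : ℝ≥0∞) ∂(ProbabilityTheory.cond μ (X 0 ⁻¹' {i}))

end Chain

/-! ### Spanning in-forests of a weighted digraph -/

section Forest

variable {V : Type*} [Fintype V] [DecidableEq V]

/-- The arcs of the loopless weighted digraph of `T`: the pairs `(i, j)` with `i ≠ j` and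
`T i j ≠ 0`. The arc `(i, j)` has weight `T i j`. -/
noncomputable def arcs (T : Matrix V V ℝ) : Finset (V × V) :=
  open Classical in Finset.univ.filter fun a => a.1 ≠ a.2 ∧ T a.1 a.2 ≠ 0

/-- The weight of the spanning subgraph with arc set `A`: the product of its arc weights. -/
def weight (T : Matrix V V ℝ) (A : Finset (V × V)) : ℝ := ∏ a ∈ A, T a.1 a.2

/-- The outdegree of `v` in the spanning subgraph with arc set `A`. -/
def outDegree (A : Finset (V × V)) (v : V) : ℕ := (A.filter fun a => a.1 = v).card

/-- The undirected graph underlying the digraph with vertex set `V` and arc set `A`. -/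
def underlying (A : Finset (V × V)) : SimpleGraph V :=
  SimpleGraph.fromRel fun u v => (u, v) ∈ A

/-- The weak components of the digraph with vertex set `V` and arc set `A`. -/
abbrev WeakComponent (A : Finset (V × V)) : Type _ := (underlying A).ConnectedComponent

/-- The weak component `c` is a tree converging to `r`: the vertex `r` lies in `c` and has outdegree
zero, and the remaining vertices of `c` have outdegree one. -/
def ConvergesTo (A : Finset (V × V)) (c : WeakComponent A) (r : V) : Prop :=
  r ∈ c.supp ∧ outDegree A r = 0 ∧ ∀ v ∈ c.supp, v ≠ r → outDegree A v = 1

/-- The spanning subgraph with arc set `A` is an in-forest: all of its weak components are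
converging trees. -/
def IsInForest (A : Finset (V × V)) : Prop := ∀ c : WeakComponent A, ∃ r, ConvergesTo A c r

/-- An in-forest that consists of exactly `k` trees. -/
def IsInForestWithTrees (A : Finset (V × V)) (k : ℕ) : Prop :=
  IsInForest A ∧ Nat.card (WeakComponent A) = k

/-- `q_j`: the total weight of the spanning trees converging to `j`. -/
noncomputable def treeWeight (T : Matrix V V ℝ) (j : V) : ℝ :=
  open Classical in
  ∑ A ∈ (arcs T).powerset.filter (fun A =>
      IsInForestWithTrees A 1 ∧ ∃ c : WeakComponent A, ConvergesTo A c j),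
    weight T A

/-- The normalization of `q_j` by `∑ k, q_k`. -/
noncomputable def normalizedTreeWeight (T : Matrix V V ℝ) (j : V) : ℝ :=
  treeWeight T j / ∑ k, treeWeight T k

/-- `f_ij`: the total weight of the in-forests with exactly two trees, one of which contains `i`
while the other converges to `j`. -/
noncomputable def forestWeight (T : Matrix V V ℝ) (i j : V) : ℝ :=
  open Classical in
  ∑ A ∈ (arcs T).powerset.filter (fun A =>
      IsInForestWithTrees A 2 ∧
        ∃ c d : WeakComponent A, c ≠ d ∧ i ∈ c.supp ∧ ConvergesTo A d j),
    weight T A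

end Forest

end MFPT

/-!
The mean first passage times to `j` are the nonnegative solution of the first-step equations
`m i = 1 + ∑ k ≠ j, T i k * m k`, and the tree and forest weights solve these equations.

On the probabilistic side, let `Q = taboo T j` be the matrix `T` with the column of `j` set to zero.
The Markov property gives `Pr(F_j > p | X 0 = i) = (Q ^ p 1) i`
(`IsMarkovChain.cond_lt_firstPassageTime`), so the mean first passage time is the sum of the series
`∑ Q ^ p 1`. A nonnegative solution `x` of `x = 1 + Q x` bounds the partial sums of this series;
hence `Q ^ p 1` tends to zero, and with it the remainder `Q ^ p x`, so that `x` is the sum of the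
series (`hasSum_pow_mulVec_one`). In particular the mean first passage times are finite.

On the combinatorial side, an in-forest is encoded by its parent map `p : V → V`, with `p r = r` at
the roots `r`. For a vertex `i`, the swap `(p, k) ↦ (update p i k, p i)` exchanges the arc of `p` out
of `i` for an additional arc `(i, k)`. It is an involution, and it preserves the product of the
weights if loops are given weight one. For `i ≠ j`, it matches the pairs in which `i`, but not `k`,
lies outside the tree of `j` with the pairs in which `k`, but not `i`, does, together with the trees
converging to `j` (these occur when `i` is itself a root). This is
`f i j = q j + ∑ k, T i k * f k j` (`forestWeight_first_step`). For `i = j`, it joins the root `j` of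
a forest with two trees to a vertex `k` of the other tree, which yields every tree whose root is not
`j` exactly once: `∑ r, q r = q j + ∑ k, T j k * f k j` (`sum_treeWeight_first_step`). After division
by `q j`, which is positive by irreducibility (`treeWeight_pos`), these are the first-step equations.
-/

namespace MFPT

/-! ### Parent maps and the arc swap -/

section ParentMap

variable {V : Type*}

/-- Iterating the map `p` from `v` eventually meets `t`. When `p` sends each vertex of an in-forest
to its parent, and each root to itself, this says that `t` is an ancestor of `v` or `v` itself. -/
def Reaches (p : V → V) (v t : V) : Prop := ∃ k : ℕ, p^[k] v = t

lemma Reaches.refl (p : V → V) (v : V) : Reaches p v v := ⟨0, rfl⟩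

lemma Reaches.head {p : V → V} {v t : V} (h : Reaches p (p v) t) : Reaches p v t := by
  obtain ⟨k, hk⟩ := h
  exact ⟨k + 1, by rwa [Function.iterate_succ_apply]⟩

lemma Reaches.trans {p : V → V} {u v t : V} (h : Reaches p u v) (h' : Reaches p v t) :
    Reaches p u t := by
  obtain ⟨k, rfl⟩ := h
  obtain ⟨l, rfl⟩ := h'
  exact ⟨l + k, by rw [Function.iterate_add_apply]⟩

lemma Reaches.eq_or_next {p : V → V} {v t : V} (h : Reaches p v t) :
    v = t ∨ Reaches p (p v) t := by
  obtain ⟨k, hk⟩ := h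
  cases k with
  | zero => exact Or.inl hk
  | succ k => exact Or.inr ⟨k, by rwa [Function.iterate_succ_apply] at hk⟩

lemma Reaches.of_fixed {p : V → V} {v t : V} (hv : p v = v) (h : Reaches p v t) : v = t := by
  obtain ⟨k, hk⟩ := h
  rw [← hk, Function.iterate_fixed hv]

/-- The fixed point to which a vertex is led is unique. -/
lemma Reaches.unique {p : V → V} {v s t : V} (hs : p s = s) (ht : p t = t)
    (h : Reaches p v s) (h' : Reaches p v t) : s = t := by
  obtain ⟨k, hk⟩ := h
  obtain ⟨l, hl⟩ := h'
  have h1 : p^[l + k] v = s := by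
    rw [Function.iterate_add_apply, hk, Function.iterate_fixed hs]
  have h2 : p^[l + k] v = t := by
    rw [add_comm, Function.iterate_add_apply, hl, Function.iterate_fixed ht]
  rw [← h1, h2]

lemma Reaches.next {p : V → V} {v t : V} (ht : p t = t) (h : Reaches p v t) :
    Reaches p (p v) t := by
  rcases h.eq_or_next with rfl | h
  · rw [ht]; exact Reaches.refl _ _
  · exact h

/-- A vertex that is led to a fixed point other than itself does not lie on a cycle. -/
lemma Reaches.not_cycle {p : V → V} {i t : V} (ht : p t = t) (h : Reaches p i t) (hit : i ≠ t) :
    ¬ Reaches p (p i) i := by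
  rintro ⟨c, hc⟩
  obtain ⟨k, hk⟩ := h
  have hc' : p^[c + 1] i = i := by rwa [Function.iterate_succ_apply]
  have h1 : p^[(c + 1) * k] i = i := by
    rw [Function.iterate_mul, Function.iterate_fixed hc']
  have h2 : p^[c * k + k] i = t := by
    rw [Function.iterate_add_apply, hk, Function.iterate_fixed ht]
  exact hit (by rw [← h1, ← h2, Nat.succ_mul])

variable [DecidableEq V]

/-- After the arc out of `i` has been redirected, an orbit still arrives where it did before unless
it runs through `i`, and then the new orbit runs through `i` as well. -/
lemma Reaches.update {p : V → V} {v t : V} (i k : V) (h : Reaches p v t) :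
    Reaches (Function.update p i k) v t ∨
      (Reaches p v i ∧ Reaches (Function.update p i k) v i) := by
  obtain ⟨n, hn⟩ := h
  induction n generalizing v with
  | zero => exact Or.inl ⟨0, hn⟩
  | succ n ih =>
    by_cases hv : v = i
    · subst hv
      exact Or.inr ⟨Reaches.refl _ _, Reaches.refl _ _⟩
    · have hp : Function.update p i k v = p v := Function.update_of_ne hv _ _
      rcases ih (v := p v) (by rwa [Function.iterate_succ_apply] at hn) with h | ⟨h, h'⟩
      · exact Or.inl (Reaches.head (by rwa [hp]))
      · exact Or.inr ⟨h.head, Reaches.head (by rwa [hp])⟩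

lemma Reaches.update_next {p : V → V} {i t : V} (k : V) (ht : p t = t) (h : Reaches p i t)
    (hit : i ≠ t) : Reaches (Function.update p i k) (p i) t :=
  ((h.next ht).update i k).resolve_right fun h' => h.not_cycle ht hit h'.1

/-- The parent map `p` encodes a spanning tree converging to `j`. -/
def IsTreeMap (j : V) (p : V → V) : Prop := p j = j ∧ ∀ v, Reaches p v j

/-- The parent map `p` encodes an in-forest with the two roots `j` and `r`, in which `i` belongs to
the tree converging to `r`. -/
def IsTwoTreeMap (j r i : V) (p : V → V) : Prop :=
  p j = j ∧ p r = r ∧ r ≠ j ∧ Reaches p i r ∧ ∀ v, Reaches p v j ∨ Reaches p v r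

/-- Redirect the arc of `x.1` out of `i` towards `x.2`, and remember its old head. -/
def swapArc (i : V) (x : (V → V) × V) : (V → V) × V := (Function.update x.1 i x.2, x.1 i)

lemma swapArc_swapArc (i : V) (x : (V → V) × V) : swapArc i (swapArc i x) = x := by
  simp [swapArc]

/-- If `i` hangs below the root `r ≠ j` and `k` below `j`, then redirecting the arc out of `i`
towards `k` moves the descendants of `i` to the tree of `j`. The tree of `r` disappears exactly if
`i = r`. -/
lemma IsTwoTreeMap.swap {i j r k : V} {p : V → V} (hij : i ≠ j) (h : IsTwoTreeMap j r i p)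
    (hk : ¬ ∃ s, IsTwoTreeMap j s k p) :
    ((∃ s, IsTwoTreeMap j s (p i) (Function.update p i k)) ∧
        ¬ ∃ s, IsTwoTreeMap j s i (Function.update p i k)) ∨
      (IsTreeMap j (Function.update p i k) ∧ p i = i) := by
  obtain ⟨hj, hr, hrj, hir, hall⟩ := h
  have hkj : Reaches p k j :=
    (hall k).resolve_right fun h => hk ⟨r, hj, hr, hrj, h, hall⟩
  have hinj : ¬ Reaches p i j := fun h => hrj (hir.unique hr hj h)
  have hkj' : Reaches (Function.update p i k) k j :=
    (hkj.update i k).resolve_right fun h => hinj <| by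
      rcases hall i with h' | h'
      · exact h'
      · exact absurd ((h.1.trans h').unique hr hj hkj) hrj
  have hij' : Reaches (Function.update p i k) i j := Reaches.head (by simpa using hkj')
  have hj' : Function.update p i k j = j := by rwa [Function.update_of_ne hij.symm]
  by_cases hri : r = i
  · subst hri
    refine Or.inr ⟨⟨hj', fun v => ?_⟩, hr⟩
    rcases hall v with h | h
    · rcases h.update r k with h | h
      · exact h
      · exact h.2.trans hij'
    · rcases h.update r k with h | h
      · exact h.trans hij'
      · exact h.2.trans hij'
  · have hr' : Function.update p i k r = r := by rwa [Function.update_of_ne hri]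
    refine Or.inl ⟨⟨r, hj', hr', hrj, hir.update_next k hr (Ne.symm hri), fun v => ?_⟩, ?_⟩
    · rcases hall v with h | h
      · rcases h.update i k with h | h
        · exact Or.inl h
        · exact Or.inl (h.2.trans hij')
      · rcases h.update i k with h | h
        · exact Or.inr h
        · exact Or.inl (h.2.trans hij')
    · rintro ⟨s, -, hs, hsj, his, -⟩
      exact hsj (his.unique hs hj' hij')

/-- Conversely, if `k` hangs below the root `r ≠ j` and `i` below `j`, then redirecting the arc out
of `i` towards `k` moves the descendants of `i` to the tree of `r`. -/
lemma IsTwoTreeMap.swap' {i j r k : V} {p : V → V} (hij : i ≠ j) (h : IsTwoTreeMap j r k p)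
    (hi : ¬ ∃ s, IsTwoTreeMap j s i p) :
    (∃ s, IsTwoTreeMap j s i (Function.update p i k)) ∧
      ¬ ∃ s, IsTwoTreeMap j s (p i) (Function.update p i k) := by
  obtain ⟨hj, hr, hrj, hkr, hall⟩ := h
  have hinr : ¬ Reaches p i r := fun h => hi ⟨r, hj, hr, hrj, h, hall⟩
  have hiJ : Reaches p i j := (hall i).resolve_right hinr
  have hj' : Function.update p i k j = j := by rwa [Function.update_of_ne hij.symm]
  have hri : r ≠ i := by
    rintro rfl
    exact hinr (Reaches.refl _ _)
  have hr' : Function.update p i k r = r := by rwa [Function.update_of_ne hri]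
  have hkr' : Reaches (Function.update p i k) k r :=
    (hkr.update i k).resolve_right fun h => hrj (hkr.unique hr hj (h.1.trans hiJ))
  have hir' : Reaches (Function.update p i k) i r := Reaches.head (by simpa using hkr')
  refine ⟨⟨r, hj', hr', hrj, hir', fun v => ?_⟩, ?_⟩
  · rcases hall v with h | h
    · rcases h.update i k with h | h
      · exact Or.inl h
      · exact Or.inr (h.2.trans hir')
    · rcases h.update i k with h | h
      · exact Or.inr h
      · exact Or.inr (h.2.trans hir')
  · rintro ⟨s, -, hs, hsj, his, -⟩
    exact hsj (his.unique hs hj' (hiJ.update_next k hj hij))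

/-- Deleting the arc out of `i ≠ j` from a tree converging to `j` detaches the tree converging to
`i`; the old head of the arc stays in the tree of `j`. -/
lemma IsTreeMap.swap {i j : V} {p : V → V} (hij : i ≠ j) (h : IsTreeMap j p) :
    (∃ s, IsTwoTreeMap j s i (Function.update p i i)) ∧
      ¬ ∃ s, IsTwoTreeMap j s (p i) (Function.update p i i) := by
  obtain ⟨hj, hall⟩ := h
  have hj' : Function.update p i i j = j := by rwa [Function.update_of_ne hij.symm]
  refine ⟨⟨i, hj', by simp, hij, Reaches.refl _ _, fun v => ?_⟩, ?_⟩
  · exact ((hall v).update i i).imp id And.right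
  · rintro ⟨s, -, hs, hsj, his, -⟩
    exact hsj (his.unique hs hj' ((hall i).update_next i hj hij))

/-- Joining the root `j` to a vertex `k` of the other tree, with root `r`, gives a tree converging
to `r`. -/
lemma IsTwoTreeMap.join {j r k : V} {p : V → V} (h : IsTwoTreeMap j r k p) :
    IsTreeMap r (Function.update p j k) := by
  obtain ⟨hj, hr, hrj, hkr, hall⟩ := h
  have hkr' : Reaches (Function.update p j k) k r :=
    (hkr.update j k).resolve_right fun h => hrj (hkr.unique hr hj h.1)
  have hjr' : Reaches (Function.update p j k) j r := Reaches.head (by simpa using hkr')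
  refine ⟨by rwa [Function.update_of_ne hrj], fun v => ?_⟩
  rcases hall v with h | h
  · rcases h.update j k with h | h
    · exact h.trans hjr'
    · exact h.2.trans hjr'
  · rcases h.update j k with h | h
    · exact h
    · exact h.2.trans hjr'

/-- Deleting the arc out of `j` from a tree converging to `r ≠ j` leaves the old head of that arc in
the tree of `r`. -/
lemma IsTreeMap.cut {j r : V} {p : V → V} (hrj : r ≠ j) (h : IsTreeMap r p) :
    IsTwoTreeMap j r (p j) (Function.update p j j) := by
  obtain ⟨hr, hall⟩ := h
  refine ⟨by simp, by rwa [Function.update_of_ne hrj], hrj,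
    (hall j).update_next j hr hrj.symm, fun v => ?_⟩
  exact ((hall v).update j j).symm.imp And.right id

end ParentMap

/-! ### Linear relations between tree and forest weights -/

section Weights

variable {V : Type*} [Fintype V] [DecidableEq V]

/-- The weight of the arc `(v, w)`, where the loops that mark the roots of a parent map have
weight one. -/
def loopWeight (T : Matrix V V ℝ) (v w : V) : ℝ := if v = w then 1 else T v w

/-- The weight of the in-forest encoded by the parent map `p`. -/
def mapWeight (T : Matrix V V ℝ) (p : V → V) : ℝ := ∏ v, loopWeight T v (p v)

/-- The swap preserves the weight of a forest together with an additional arc out of `i`. -/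
lemma mapWeight_swapArc (T : Matrix V V ℝ) (i : V) (x : (V → V) × V) :
    mapWeight T (swapArc i x).1 * loopWeight T i (swapArc i x).2 =
      mapWeight T x.1 * loopWeight T i x.2 := by
  have key : ∀ q : V → V, mapWeight T q =
      loopWeight T i (q i) * ∏ v ∈ Finset.univ.erase i, loopWeight T v (q v) := fun q =>
    (Finset.mul_prod_erase _ (fun v => loopWeight T v (q v)) (Finset.mem_univ i)).symm
  have hrest : ∏ v ∈ Finset.univ.erase i, loopWeight T v (Function.update x.1 i x.2 v) =
      ∏ v ∈ Finset.univ.erase i, loopWeight T v (x.1 v) :=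
    Finset.prod_congr rfl fun v hv => by
      rw [Function.update_of_ne (Finset.ne_of_mem_erase hv)]
  simp only [swapArc]
  rw [key, key x.1, hrest, Function.update_self]
  ring

open Classical in
/-- The sum of `mapWeight` over the parent maps with the property `P`. -/
noncomputable def mapSum (T : Matrix V V ℝ) (P : (V → V) → Prop) : ℝ :=
  ∑ p, if P p then mapWeight T p else 0

open Classical in
/-- The total weight of the pairs `x` with the property `D` that consist of a parent map `x.1` and
the arc `(i, x.2)`. -/
noncomputable def pairSum (T : Matrix V V ℝ) (i : V) (D : (V → V) × V → Prop) : ℝ :=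
  ∑ x, if D x then mapWeight T x.1 * loopWeight T i x.2 else 0

lemma sum_loopWeight_mul_mapSum (T : Matrix V V ℝ) (i : V) (P : V → (V → V) → Prop) :
    ∑ k, loopWeight T i k * mapSum T (P k) = pairSum T i fun x => P x.2 x.1 := by
  rw [pairSum, Fintype.sum_prod_type_right]
  refine Finset.sum_congr rfl fun k _ => ?_
  rw [mapSum, Finset.mul_sum]
  refine Finset.sum_congr rfl fun p _ => ?_
  split_ifs <;> ring

lemma mapSum_eq_pairSum (T : Matrix V V ℝ) (i : V) (P : (V → V) → Prop) :
    mapSum T P = pairSum T i fun x => P x.1 ∧ x.2 = i := by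
  rw [pairSum, Fintype.sum_prod_type_right, Finset.sum_eq_single i]
  · refine Finset.sum_congr rfl fun p _ => ?_
    by_cases h : P p <;> simp [h, loopWeight]
  · intro k _ hk
    simp [hk]
  · simp

/-- Two sets of pairs that are exchanged by `swapArc i` have the same weight. -/
lemma pairSum_congr_swapArc (T : Matrix V V ℝ) (i : V) (D E : (V → V) × V → Prop)
    (hDE : ∀ x, D x → E (swapArc i x)) (hED : ∀ x, E x → D (swapArc i x)) :
    pairSum T i D = pairSum T i E := by
  refine Finset.sum_nbij' (swapArc i) (swapArc i) (by simp) (by simp)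
    (fun x _ => swapArc_swapArc i x) (fun x _ => swapArc_swapArc i x) fun x _ => ?_
  rw [mapWeight_swapArc]
  have : D x ↔ E (swapArc i x) :=
    ⟨hDE x, fun h => by simpa [swapArc_swapArc] using hED _ h⟩
  by_cases h : D x
  · rw [if_pos h, if_pos (this.1 h)]
  · rw [if_neg h, if_neg fun h' => h (this.2 h')]

lemma mapSum_exists (T : Matrix V V ℝ) (P : V → (V → V) → Prop)
    (huniq : ∀ p r s, P r p → P s p → r = s) :
    mapSum T (fun p => ∃ r, P r p) = ∑ r, mapSum T (P r) := by
  classical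
  simp only [mapSum]
  rw [Finset.sum_comm]
  refine Finset.sum_congr rfl fun p _ => ?_
  by_cases h : ∃ r, P r p
  · obtain ⟨r, hr⟩ := h
    rw [if_pos ⟨r, hr⟩, Finset.sum_eq_single r, if_pos hr]
    · intro s _ hs
      exact if_neg fun h => hs (huniq p s r h hr)
    · simp
  · rw [if_neg h, Finset.sum_eq_zero]
    intro r _
    exact if_neg fun hr => h ⟨r, hr⟩

/-- The first-step relation for forests, with loops of weight one included on both sides. Summed over
`k`, the pairs (forest with `i` outside the tree of `j`, arc `(i, k)`) are compared with the pairs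
(forest with `k` outside the tree of `j`, arc `(i, k)`). The common pairs cancel, and the swap
exchanges the remaining ones, up to the trees converging to `j`. -/
lemma mapSum_twoTree_relation (T : Matrix V V ℝ) {i j : V} (hij : i ≠ j) :
    (∑ k, loopWeight T i k) * mapSum T (fun p => ∃ r, IsTwoTreeMap j r i p) =
      ∑ k, loopWeight T i k * mapSum T (fun p => ∃ r, IsTwoTreeMap j r k p) +
        mapSum T (IsTreeMap j) := by
  classical
  have hswap := pairSum_congr_swapArc T i
    (fun x => (∃ r, IsTwoTreeMap j r i x.1) ∧ ¬ ∃ r, IsTwoTreeMap j r x.2 x.1)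
    (fun x => ((∃ r, IsTwoTreeMap j r x.2 x.1) ∧ ¬ ∃ r, IsTwoTreeMap j r i x.1) ∨
      (IsTreeMap j x.1 ∧ x.2 = i))
    (fun x ⟨⟨r, hr⟩, hx⟩ => hr.swap hij hx)
    (by
      rintro ⟨p, k⟩ (⟨⟨r, hr⟩, hx⟩ | ⟨hp, hk⟩)
      · exact hr.swap' hij hx
      · obtain rfl : k = i := hk
        exact hp.swap hij)
  have htree := mapSum_eq_pairSum T i (IsTreeMap j)
  rw [Finset.sum_mul, sum_loopWeight_mul_mapSum T i
    (fun _ p => ∃ r, IsTwoTreeMap j r i p), sum_loopWeight_mul_mapSum T i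
    (fun k p => ∃ r, IsTwoTreeMap j r k p), htree]
  simp only [pairSum] at hswap ⊢
  rw [← sub_eq_iff_eq_add', ← Finset.sum_sub_distrib]
  rw [← sub_eq_zero, ← Finset.sum_sub_distrib] at hswap ⊢
  rw [← hswap]
  refine Finset.sum_congr rfl fun x _ => ?_
  -- A tree has a single root, hence is not a forest with two roots.
  have hdisj : ¬ ((∃ r, IsTwoTreeMap j r x.2 x.1) ∧ IsTreeMap j x.1) := by
    rintro ⟨⟨r, -, hr, hrj, -⟩, -, hall⟩
    exact hrj (Reaches.of_fixed hr (hall r))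
  by_cases h1 : ∃ r, IsTwoTreeMap j r i x.1 <;> by_cases h2 : ∃ r, IsTwoTreeMap j r x.2 x.1 <;>
    by_cases h3 : IsTreeMap j x.1 <;> by_cases h4 : x.2 = i <;> simp_all

lemma mapSum_twoTree_self (T : Matrix V V ℝ) (j : V) :
    mapSum T (fun p => ∃ r, IsTwoTreeMap j r j p) = 0 := by
  classical
  refine Finset.sum_eq_zero fun p _ => if_neg ?_
  rintro ⟨r, hj, -, hrj, hjr, -⟩
  exact hrj (Reaches.of_fixed hj hjr).symm

/-- Every tree whose root is not `j` arises in exactly one way by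
joining the root `j` of a forest with two trees to a vertex `k` of the other tree. -/
lemma mapSum_tree_relation (T : Matrix V V ℝ) (j : V) :
    mapSum T (IsTreeMap j) +
        ∑ k, loopWeight T j k * mapSum T (fun p => ∃ r, IsTwoTreeMap j r k p) =
      ∑ r, mapSum T (IsTreeMap r) := by
  classical
  have hswap := pairSum_congr_swapArc T j (fun x => ∃ r, IsTwoTreeMap j r x.2 x.1)
    (fun x => (∃ r, r ≠ j ∧ IsTreeMap r x.1) ∧ x.2 = j)
    (fun x ⟨r, hr⟩ => ⟨⟨r, hr.2.2.1, hr.join⟩, hr.1⟩)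
    (by
      rintro ⟨p, k⟩ ⟨⟨r, hrj, hr⟩, hk⟩
      obtain rfl : k = j := hk
      exact ⟨r, hr.cut hrj⟩)
  have htree := mapSum_eq_pairSum T j (fun p => ∃ r, r ≠ j ∧ IsTreeMap r p)
  rw [sum_loopWeight_mul_mapSum T j (fun k p => ∃ r, IsTwoTreeMap j r k p), hswap, ← htree,
    mapSum_exists T (fun r p => r ≠ j ∧ IsTreeMap r p)
      (fun p r s hr hs => Reaches.of_fixed hr.2.1 (hs.2.2 r)),
    ← Finset.add_sum_erase _ _ (Finset.mem_univ j),
    ← Finset.add_sum_erase _ (fun r => mapSum T (IsTreeMap r)) (Finset.mem_univ j)]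
  have h0 : mapSum T (fun p => j ≠ j ∧ IsTreeMap j p) = 0 := by simp [mapSum]
  rw [h0, zero_add]
  congr 1
  refine Finset.sum_congr rfl fun r hr => ?_
  simp [mapSum, Finset.ne_of_mem_erase hr]

end Weights

/-! ### In-forests as parent maps -/

section Encoding

variable {V : Type*} [Fintype V] [DecidableEq V]

/-- The arcs `(v, p v)` of a parent map `p`; the vertices fixed by `p` have no arc. -/
def parentArcs (p : V → V) : Finset (V × V) :=
  (Finset.univ.filter fun v => p v ≠ v).image fun v => (v, p v)

lemma mem_parentArcs {p : V → V} {u v : V} : (u, v) ∈ parentArcs p ↔ u ≠ v ∧ p u = v := by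
  simp only [parentArcs, Finset.mem_image, Finset.mem_filter, Finset.mem_univ, true_and,
    Prod.mk.injEq]
  constructor
  · rintro ⟨w, hw, rfl, rfl⟩
    exact ⟨hw.symm, rfl⟩
  · rintro ⟨h, rfl⟩
    exact ⟨u, h.symm, rfl, rfl⟩

lemma parentArcs_injective : Function.Injective (parentArcs : (V → V) → Finset (V × V)) := by
  intro p q h
  funext v
  by_contra hpq
  by_cases hp : p v = v
  · have hq : (v, q v) ∈ parentArcs q := mem_parentArcs.2 ⟨fun h => hpq (hp.trans h), rfl⟩
    rw [← h] at hq
    exact hpq (mem_parentArcs.1 hq).2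
  · have hq : (v, p v) ∈ parentArcs p := mem_parentArcs.2 ⟨fun h => hp h.symm, rfl⟩
    rw [h] at hq
    exact hpq (mem_parentArcs.1 hq).2.symm

lemma weight_parentArcs (T : Matrix V V ℝ) (p : V → V) :
    weight T (parentArcs p) = mapWeight T p := by
  rw [weight, parentArcs, Finset.prod_image, Finset.prod_filter]
  · refine Finset.prod_congr rfl fun v _ => ?_
    by_cases h : p v = v
    · simp [loopWeight, h]
    · simp [loopWeight, h, Ne.symm h]
  · intro u _ v _ h
    exact (Prod.mk.inj h).1

lemma parentArcs_subset_arcs {T : Matrix V V ℝ} {p : V → V} (h : mapWeight T p ≠ 0) :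
    parentArcs p ⊆ arcs T := by
  rintro ⟨u, v⟩ huv
  obtain ⟨hne, rfl⟩ := mem_parentArcs.1 huv
  have := Finset.prod_ne_zero_iff.1 h u (Finset.mem_univ u)
  rw [loopWeight, if_neg hne] at this
  simp [arcs, hne, this]

lemma outDegree_parentArcs (p : V → V) (v : V) :
    outDegree (parentArcs p) v = if p v = v then 0 else 1 := by
  split_ifs with h
  · rw [outDegree, Finset.card_eq_zero, Finset.filter_eq_empty_iff]
    rintro ⟨u, w⟩ huw rfl
    obtain ⟨h1, h2⟩ := mem_parentArcs.1 huw
    exact h1 (h.symm.trans h2)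
  · rw [outDegree, Finset.card_eq_one]
    refine ⟨(v, p v), ?_⟩
    ext ⟨u, w⟩
    simp only [Finset.mem_filter, mem_parentArcs, Finset.mem_singleton, Prod.mk.injEq]
    constructor
    · rintro ⟨⟨-, rfl⟩, rfl⟩
      exact ⟨rfl, rfl⟩
    · rintro ⟨rfl, rfl⟩
      exact ⟨⟨fun h' => h h'.symm, rfl⟩, rfl⟩

lemma underlying_parentArcs_adj {p : V → V} {u v : V} :
    (underlying (parentArcs p)).Adj u v ↔ u ≠ v ∧ (p u = v ∨ p v = u) := by
  simp only [underlying, SimpleGraph.fromRel_adj, mem_parentArcs]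
  constructor
  · rintro ⟨h, h' | h'⟩
    · exact ⟨h, Or.inl h'.2⟩
    · exact ⟨h, Or.inr h'.2⟩
  · rintro ⟨h, h' | h'⟩
    · exact ⟨h, Or.inl ⟨h, h'⟩⟩
    · exact ⟨h, Or.inr ⟨h.symm, h'⟩⟩

/-- The weak component of a root consists of the vertices that are led to it. -/
lemma reachable_root_iff {p : V → V} {r : V} (hr : p r = r) (v : V) :
    (underlying (parentArcs p)).Reachable v r ↔ Reaches p v r := by
  constructor
  · rintro ⟨w⟩
    induction w with
    | nil => exact Reaches.refl _ _
    | cons hadj _ ih =>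
      rcases (underlying_parentArcs_adj.1 hadj).2 with h | h
      · exact Reaches.head (h ▸ ih hr)
      · exact h ▸ (ih hr).next hr
  · rintro ⟨k, hk⟩
    induction k generalizing v with
    | zero => rw [← hk]; exact SimpleGraph.Reachable.refl _
    | succ k ih =>
      have h := ih (p v) (by rwa [Function.iterate_succ_apply] at hk)
      by_cases hv : p v = v
      · rwa [hv] at h
      · exact (underlying_parentArcs_adj.2 ⟨Ne.symm hv, Or.inl rfl⟩).reachable.trans h

lemma convergesTo_parentArcs_iff {p : V → V} {c : WeakComponent (parentArcs p)} {r : V} :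
    ConvergesTo (parentArcs p) c r ↔
      p r = r ∧ c = (underlying (parentArcs p)).connectedComponentMk r := by
  constructor
  · rintro ⟨hc, hr, -⟩
    refine ⟨?_, ((SimpleGraph.ConnectedComponent.mem_supp_iff _ _).1 hc).symm⟩
    by_contra h
    simp [outDegree_parentArcs, h] at hr
  · rintro ⟨hr, rfl⟩
    refine ⟨rfl, by simp [outDegree_parentArcs, hr], fun v hv hvr => ?_⟩
    have hvr' : Reaches p v r := (reachable_root_iff hr v).1 <|
      SimpleGraph.ConnectedComponent.exact <|
        (SimpleGraph.ConnectedComponent.mem_supp_iff _ _).1 hv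
    rw [outDegree_parentArcs, if_neg fun h => hvr (Reaches.of_fixed h hvr')]

lemma mk_eq_mk_root_iff {p : V → V} {r : V} (hr : p r = r) (v : V) :
    (underlying (parentArcs p)).connectedComponentMk v =
      (underlying (parentArcs p)).connectedComponentMk r ↔ Reaches p v r := by
  rw [SimpleGraph.ConnectedComponent.eq, reachable_root_iff hr]

/-- Every in-forest without loops comes from a parent map. -/
lemma IsInForest.exists_parentArcs {T : Matrix V V ℝ} {A : Finset (V × V)} (hA : A ⊆ arcs T)
    (h : IsInForest A) : ∃ p, parentArcs p = A := by
  classical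
  have hloop : ∀ u v, (u, v) ∈ A → u ≠ v := fun u v huv => by
    have := hA huv
    simp only [arcs, Finset.mem_filter] at this
    exact this.2.1
  have hdeg : ∀ v, outDegree A v ≤ 1 := fun v => by
    obtain ⟨r, -, hr, hr'⟩ := h ((underlying A).connectedComponentMk v)
    by_cases hv : v = r
    · rw [hv, hr]; exact zero_le_one
    · exact (hr' v rfl hv).le
  have huniq : ∀ u v w, (u, v) ∈ A → (u, w) ∈ A → v = w := fun u v w hv hw => by
    have := Finset.card_le_one.1 (hdeg u) (u, v) (by simp [hv]) (u, w) (by simp [hw])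
    exact (Prod.mk.inj this).2
  refine ⟨fun v => if h : ∃ w, (v, w) ∈ A then h.choose else v, ?_⟩
  ext ⟨u, v⟩
  rw [mem_parentArcs]
  constructor
  · rintro ⟨huv, h⟩
    split_ifs at h with hu
    · rw [← h]; exact hu.choose_spec
    · exact absurd h huv
  · intro huv
    have hu : ∃ w, (u, w) ∈ A := ⟨v, huv⟩
    refine ⟨hloop u v huv, ?_⟩
    rw [dif_pos hu]
    exact huniq u _ _ hu.choose_spec huv

open Classical in
lemma mapSum_eq_sum_filter (T : Matrix V V ℝ) (P : (V → V) → Prop) :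
    mapSum T P = ∑ p with P p, mapWeight T p := (Finset.sum_filter _ _).symm

/-- A sum over sets of arcs that are in-forests is a sum over parent maps: a parent map using a pair
that is not an arc has weight zero. -/
lemma sum_weight_eq_mapSum (T : Matrix V V ℝ) (Q : Finset (V × V) → Prop) {hdec : DecidablePred Q}
    (hQ : ∀ A, Q A → IsInForest A) :
    ∑ A ∈ (arcs T).powerset.filter Q, weight T A = mapSum T fun p => Q (parentArcs p) := by
  classical
  obtain rfl : hdec = fun A => Classical.propDecidable (Q A) := Subsingleton.elim _ _
  rw [mapSum_eq_sum_filter]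
  symm
  refine Finset.sum_bij_ne_zero (fun p _ _ => parentArcs p) ?_ ?_ ?_ ?_
  · intro p hp hp0
    rw [Finset.mem_filter, Finset.mem_powerset]
    exact ⟨parentArcs_subset_arcs hp0, (Finset.mem_filter.1 hp).2⟩
  · intro p _ _ q _ _ h
    exact parentArcs_injective h
  · intro A hA hA0
    rw [Finset.mem_filter, Finset.mem_powerset] at hA
    obtain ⟨p, rfl⟩ := (hQ A hA.2).exists_parentArcs hA.1
    rw [weight_parentArcs] at hA0
    exact ⟨p, Finset.mem_filter.2 ⟨Finset.mem_univ p, hA.2⟩, hA0, rfl⟩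
  · intro p _ _
    exact (weight_parentArcs T p).symm

lemma isTree_parentArcs_iff (j : V) (p : V → V) :
    (IsInForestWithTrees (parentArcs p) 1 ∧
      ∃ c : WeakComponent (parentArcs p), ConvergesTo (parentArcs p) c j) ↔ IsTreeMap j p := by
  constructor
  · rintro ⟨⟨-, hcard⟩, c, hc⟩
    obtain ⟨hj, -⟩ := convergesTo_parentArcs_iff.1 hc
    have := (Nat.card_eq_one_iff_unique.1 hcard).1
    exact ⟨hj, fun v => (mk_eq_mk_root_iff hj v).1 (Subsingleton.elim _ _)⟩
  · rintro ⟨hj, hall⟩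
    have hone : ∀ c : WeakComponent (parentArcs p),
        c = (underlying (parentArcs p)).connectedComponentMk j := fun c => by
      induction c using SimpleGraph.ConnectedComponent.ind with
      | h v => exact (mk_eq_mk_root_iff hj v).2 (hall v)
    refine ⟨⟨fun c => ⟨j, convergesTo_parentArcs_iff.2 ⟨hj, hone c⟩⟩, ?_⟩,
      _, convergesTo_parentArcs_iff.2 ⟨hj, rfl⟩⟩
    exact Nat.card_eq_one_iff_unique.2 ⟨⟨fun c d => (hone c).trans (hone d).symm⟩, ⟨Quot.mk _ j⟩⟩

lemma isTwoTree_parentArcs_iff (i j : V) (p : V → V) :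
    (IsInForestWithTrees (parentArcs p) 2 ∧ ∃ c d : WeakComponent (parentArcs p),
      c ≠ d ∧ i ∈ c.supp ∧ ConvergesTo (parentArcs p) d j) ↔ ∃ r, IsTwoTreeMap j r i p := by
  constructor
  · rintro ⟨⟨hfor, hcard⟩, c, d, hcd, hi, hd⟩
    obtain ⟨hj, rfl⟩ := convergesTo_parentArcs_iff.1 hd
    obtain ⟨r, hc⟩ := hfor c
    obtain ⟨hr, rfl⟩ := convergesTo_parentArcs_iff.1 hc
    refine ⟨r, hj, hr, fun h => hcd (by rw [h]), (mk_eq_mk_root_iff hr i).1 hi, fun v => ?_⟩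
    rw [← mk_eq_mk_root_iff hj, ← mk_eq_mk_root_iff hr]
    obtain ⟨x, y, -, hxy⟩ := Nat.card_eq_two_iff.1 hcard
    have hmem : ∀ c : WeakComponent (parentArcs p), c = x ∨ c = y := fun c => by
      have : c ∈ ({x, y} : Set _) := hxy ▸ Set.mem_univ c
      simpa using this
    rcases hmem ((underlying (parentArcs p)).connectedComponentMk v) with h1 | h1 <;>
      rcases hmem ((underlying (parentArcs p)).connectedComponentMk j) with h2 | h2 <;>
      rcases hmem ((underlying (parentArcs p)).connectedComponentMk r) with h3 | h3 <;>
      simp_all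
  · rintro ⟨r, hj, hr, hrj, hir, hall⟩
    have hne : (underlying (parentArcs p)).connectedComponentMk r ≠
        (underlying (parentArcs p)).connectedComponentMk j := fun h =>
      hrj (Reaches.of_fixed hr ((mk_eq_mk_root_iff hj r).1 h))
    have htwo : ∀ c : WeakComponent (parentArcs p),
        c = (underlying (parentArcs p)).connectedComponentMk j ∨
          c = (underlying (parentArcs p)).connectedComponentMk r := fun c => by
      induction c using SimpleGraph.ConnectedComponent.ind with
      | h v => rw [mk_eq_mk_root_iff hj, mk_eq_mk_root_iff hr]; exact hall v
    refine ⟨⟨fun c => ?_, ?_⟩, _, _, hne, (mk_eq_mk_root_iff hr i).2 hir,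
      convergesTo_parentArcs_iff.2 ⟨hj, rfl⟩⟩
    · rcases htwo c with h | h
      · exact ⟨j, convergesTo_parentArcs_iff.2 ⟨hj, h⟩⟩
      · exact ⟨r, convergesTo_parentArcs_iff.2 ⟨hr, h⟩⟩
    · refine Nat.card_eq_two_iff.2 ⟨_, _, hne, Set.eq_univ_of_forall fun c => ?_⟩
      exact (htwo c).symm

lemma treeWeight_eq_mapSum (T : Matrix V V ℝ) (j : V) :
    treeWeight T j = mapSum T (IsTreeMap j) := by
  refine (sum_weight_eq_mapSum T _ fun A h => h.1.1).trans ?_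
  congr 1
  funext p
  exact propext (isTree_parentArcs_iff j p)

lemma forestWeight_eq_mapSum (T : Matrix V V ℝ) (i j : V) :
    forestWeight T i j = mapSum T fun p => ∃ r, IsTwoTreeMap j r i p := by
  refine (sum_weight_eq_mapSum T _ fun A h => h.1.1).trans ?_
  congr 1
  funext p
  exact propext (isTwoTree_parentArcs_iff i j p)

end Encoding

/-! ### First-step equations for the weights -/

section FirstStep

variable {V : Type*} [DecidableEq V]

lemma loopWeight_nonneg {T : Matrix V V ℝ} (hT : ∀ i j, 0 ≤ T i j) (v w : V) :
    0 ≤ loopWeight T v w := by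
  rw [loopWeight]
  split_ifs
  · exact zero_le_one
  · exact hT v w

variable [Fintype V]

lemma mapWeight_nonneg {T : Matrix V V ℝ} (hT : ∀ i j, 0 ≤ T i j) (p : V → V) :
    0 ≤ mapWeight T p := Finset.prod_nonneg fun v _ => loopWeight_nonneg hT v (p v)

lemma mapSum_nonneg {T : Matrix V V ℝ} (hT : ∀ i j, 0 ≤ T i j) (P : (V → V) → Prop) :
    0 ≤ mapSum T P := by
  refine Finset.sum_nonneg fun p _ => ?_
  split_ifs
  · exact mapWeight_nonneg hT p
  · exact le_rfl

/-- Following, from every vertex, an arc that decreases the distance to `j` gives a spanning tree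
converging to `j`. -/
lemma treeWeight_pos {T : Matrix V V ℝ} (hirr : T.IsIrreducible) (j : V) :
    0 < treeWeight T j := by
  classical
  have hT := hirr.nonneg
  have hex : ∀ v, ∃ k, 0 < (T ^ k) v j := fun v =>
    ((Matrix.isIrreducible_iff_exists_pow_pos hT).1 hirr v j).imp fun _ h => h.2
  have hstep : ∀ v, ∃ w, (v = j → w = j) ∧
      (v ≠ j → 0 < T v w ∧ Nat.find (hex w) < Nat.find (hex v)) := fun v => by
    by_cases hv : v = j
    · exact ⟨j, fun _ => rfl, fun h => absurd hv h⟩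
    have hspec := Nat.find_spec (hex v)
    obtain ⟨k, hk⟩ : ∃ k, Nat.find (hex v) = k + 1 := by
      refine Nat.exists_eq_succ_of_ne_zero fun h => ?_
      rw [h, pow_zero, Matrix.one_apply_ne hv] at hspec
      exact lt_irrefl _ hspec
    rw [hk, pow_succ', Matrix.mul_apply] at hspec
    obtain ⟨w, -, hw⟩ := Finset.exists_lt_of_sum_lt (s := Finset.univ) (f := fun _ => (0 : ℝ))
      (by simpa using hspec)
    refine ⟨w, fun h => absurd h hv, fun _ => ⟨?_, ?_⟩⟩
    · exact (hT v w).lt_of_ne fun h => by simp [← h] at hw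
    · rw [hk]
      exact Nat.lt_succ_of_le (Nat.find_min' _ (pos_of_mul_pos_right hw (hT v w)))
  choose p hpj hp using hstep
  have htree : IsTreeMap j p := by
    refine ⟨hpj j rfl, fun v => ?_⟩
    induction hd : Nat.find (hex v) using Nat.strong_induction_on generalizing v with
    | _ d ih =>
      by_cases hv : v = j
      · exact hv ▸ Reaches.refl _ _
      · exact Reaches.head (ih _ (hd ▸ (hp v hv).2) _ rfl)
  rw [treeWeight_eq_mapSum]
  refine Finset.sum_pos' (fun q _ => ?_) ⟨p, Finset.mem_univ p, ?_⟩
  · split_ifs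
    · exact mapWeight_nonneg hT q
    · exact le_rfl
  · rw [if_pos htree]
    refine Finset.prod_pos fun v _ => ?_
    rw [loopWeight]
    split_ifs with h
    · exact zero_lt_one
    · refine (hp v fun hv => h ?_).1
      rw [hpj v hv, hv]

lemma forestWeight_nonneg {T : Matrix V V ℝ} (hT : ∀ i j, 0 ≤ T i j) (i j : V) :
    0 ≤ forestWeight T i j := by
  rw [forestWeight_eq_mapSum]
  exact mapSum_nonneg hT _

/-- No in-forest has `j` outside the tree converging to `j`. -/
lemma forestWeight_self (T : Matrix V V ℝ) (j : V) : forestWeight T j j = 0 := by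
  rw [forestWeight_eq_mapSum, mapSum_twoTree_self]

lemma sum_loopWeight_mul (T : Matrix V V ℝ) (i : V) (x : V → ℝ) :
    ∑ k, loopWeight T i k * x k = x i + (∑ k, T i k * x k - T i i * x i) := by
  rw [← Finset.add_sum_erase _ _ (Finset.mem_univ i),
    ← Finset.add_sum_erase _ (fun k => T i k * x k) (Finset.mem_univ i)]
  have : ∑ k ∈ Finset.univ.erase i, loopWeight T i k * x k =
      ∑ k ∈ Finset.univ.erase i, T i k * x k :=
    Finset.sum_congr rfl fun k hk => by
      rw [loopWeight, if_neg (Finset.ne_of_mem_erase hk).symm]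
  rw [this, loopWeight, if_pos rfl]
  ring

lemma forestWeight_first_step {T : Matrix V V ℝ} {i j : V} (hrow : ∑ k, T i k = 1) (hij : i ≠ j) :
    forestWeight T i j = treeWeight T j + ∑ k, T i k * forestWeight T k j := by
  have h := mapSum_twoTree_relation T hij
  simp only [← forestWeight_eq_mapSum, ← treeWeight_eq_mapSum] at h
  have h1 := sum_loopWeight_mul T i fun _ => 1
  simp only [mul_one, hrow] at h1
  rw [h1, sum_loopWeight_mul T i fun k => forestWeight T k j] at h
  linarith

lemma sum_treeWeight_first_step (T : Matrix V V ℝ) (j : V) :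
    ∑ r, treeWeight T r = treeWeight T j + ∑ k, T j k * forestWeight T k j := by
  have h := mapSum_tree_relation T j
  simp only [← forestWeight_eq_mapSum, ← treeWeight_eq_mapSum] at h
  rw [sum_loopWeight_mul T j fun k => forestWeight T k j] at h
  simp only [forestWeight_self, mul_zero, sub_zero, zero_add] at h
  exact h.symm

end FirstStep

/-! ### Survival probabilities -/

section Taboo

variable {V : Type*} [DecidableEq V]

/-- The transition matrix with the transitions into the taboo state `j` removed. -/
def taboo (T : Matrix V V ℝ) (j : V) : Matrix V V ℝ :=
  Matrix.of fun i k => if k = j then 0 else T i k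

lemma taboo_nonneg {T : Matrix V V ℝ} (hT : ∀ i j, 0 ≤ T i j) (j i k : V) :
    0 ≤ taboo T j i k := by
  rw [taboo, Matrix.of_apply]
  split_ifs
  · exact le_rfl
  · exact hT i k

variable [Fintype V]

lemma pow_apply_nonneg {Q : Matrix V V ℝ} (hQ : ∀ i k, 0 ≤ Q i k) (N : ℕ) (i k : V) :
    0 ≤ (Q ^ N) i k := by
  induction N generalizing k with
  | zero => rw [pow_zero, Matrix.one_apply]; split_ifs <;> norm_num
  | succ N ih =>
    rw [pow_succ, Matrix.mul_apply]
    exact Finset.sum_nonneg fun l _ => mul_nonneg (ih l) (hQ l k)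

/-- A nonnegative solution of `x = 1 + Q x` is the sum of the series `∑ Q ^ N 1`. Boundedness of the
partial sums forces `Q ^ N 1 → 0`, and the remainder `Q ^ N x` is at most a multiple of
`Q ^ N 1`. -/
lemma hasSum_pow_mulVec_one {Q : Matrix V V ℝ} (hQ : ∀ i k, 0 ≤ Q i k) {x : V → ℝ}
    (hx0 : ∀ i, 0 ≤ x i) (hx : x = 1 + Q.mulVec x) (i : V) :
    HasSum (fun N => ∑ k, (Q ^ N) i k) (x i) := by
  have hnn : ∀ N i, 0 ≤ ∑ k, (Q ^ N) i k := fun N i =>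
    Finset.sum_nonneg fun k _ => pow_apply_nonneg hQ N i k
  have hrem0 : ∀ N i, 0 ≤ ((Q ^ N).mulVec x) i := fun N i =>
    Finset.sum_nonneg fun k _ => mul_nonneg (pow_apply_nonneg hQ N i k) (hx0 k)
  have hone : ∀ N i, ((Q ^ N).mulVec 1) i = ∑ k, (Q ^ N) i k := fun N i => by
    simp [Matrix.mulVec, dotProduct]
  have hpart : ∀ M i, ∑ N ∈ Finset.range M, ∑ k, (Q ^ N) i k = x i - ((Q ^ M).mulVec x) i := by
    intro M i
    induction M with
    | zero => simp
    | succ M ih =>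
      have h : (Q ^ M).mulVec x = (Q ^ M).mulVec 1 + (Q ^ (M + 1)).mulVec x := by
        rw [pow_succ, ← Matrix.mulVec_mulVec, ← Matrix.mulVec_add, ← hx]
      rw [Finset.sum_range_succ, ih, h, Pi.add_apply, hone]
      ring
  have hsum : Summable fun N => ∑ k, (Q ^ N) i k :=
    summable_of_sum_range_le (hnn · i) fun M => by
      rw [hpart]
      linarith [hrem0 M i]
  have hrem : ∀ M, ((Q ^ M).mulVec x) i ≤ (∑ k, x k) * ∑ k, (Q ^ M) i k := fun M => by
    rw [Finset.mul_sum]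
    refine Finset.sum_le_sum fun k _ => ?_
    rw [mul_comm]
    exact mul_le_mul_of_nonneg_right
      (Finset.single_le_sum (fun k _ => hx0 k) (Finset.mem_univ k)) (pow_apply_nonneg hQ M i k)
  have hlim : Filter.Tendsto (fun M => ((Q ^ M).mulVec x) i) Filter.atTop (nhds 0) :=
    squeeze_zero (hrem0 · i) hrem (by simpa using hsum.tendsto_atTop_zero.const_mul (∑ k, x k))
  rw [hasSum_iff_tendsto_nat_of_nonneg (hnn · i)]
  simp only [hpart]
  simpa using hlim.const_sub (x i)

end Taboo

lemma toENNReal_eq_tsum (m : ℕ∞) :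
    (m : ℝ≥0∞) = ∑' p : ℕ, if (p : ℕ∞) < m then (1 : ℝ≥0∞) else 0 := by
  induction m using ENat.recTopCoe with
  | top =>
    simp
  | coe m =>
    rw [tsum_eq_sum (s := Finset.range m)]
    · rw [Finset.sum_congr rfl (g := fun _ => (1 : ℝ≥0∞))]
      · simp
      · intro p hp
        rw [if_pos (by exact_mod_cast Finset.mem_range.1 hp)]
    · intro p hp
      rw [if_neg]
      exact_mod_cast fun h => hp (Finset.mem_range.2 h)

lemma lt_firstPassageTime_iff {V Ω : Type*} {X : ℕ → Ω → V} (j : V) (ω : Ω) (p : ℕ) :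
    (p : ℕ∞) < firstPassageTime X j ω ↔ ∀ n ∈ Set.Icc 1 p, X n ω ≠ j := by
  rw [← not_le]
  have h : firstPassageTime X j ω ≤ (p : ℕ∞) ↔ ∃ n ∈ Set.Icc 1 p, X n ω ∈ ({j} : Set V) :=
    hittingAfter_le_iff
  rw [h]
  push Not
  rfl

lemma IsMarkovChain.measurableSet_lt_firstPassageTime {V Ω : Type*}
    [MeasurableSpace V] [MeasurableSingletonClass V] [MeasurableSpace Ω] {T : Matrix V V ℝ}
    {μ : Measure Ω} {X : ℕ → Ω → V} (hX : IsMarkovChain T μ X) (j : V) (p : ℕ) :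
    MeasurableSet {ω | (p : ℕ∞) < firstPassageTime X j ω} := by
  simp only [lt_firstPassageTime_iff]
  have : {ω | ∀ n ∈ Set.Icc 1 p, X n ω ≠ j} = ⋂ n ∈ Set.Icc 1 p, (X n ⁻¹' {j})ᶜ := by
    ext ω
    simp
  rw [this]
  exact MeasurableSet.biInter (Set.to_countable _) fun n _ =>
    (hX.measurable n (measurableSet_singleton j)).compl

section Survival

variable {V Ω : Type*} [Fintype V] [MeasurableSpace V] [MeasurableSingletonClass V]
  [MeasurableSpace Ω] {T : Matrix V V ℝ} {μ : Measure Ω} {X : ℕ → Ω → V}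

lemma measure_eq_sum_inter_fiber {W : Type*} [Fintype W] {g : Ω → W}
    (hg : ∀ y, MeasurableSet (g ⁻¹' {y})) (S : Set Ω) : μ S = ∑ y, μ (g ⁻¹' {y} ∩ S) := by
  have h := sum_measure_preimage_singleton (μ := μ.restrict S) Finset.univ fun y _ => hg y
  rw [Finset.coe_univ, Set.preimage_univ, Measure.restrict_apply_univ] at h
  rw [← h]
  exact Finset.sum_congr rfl fun y _ => Measure.restrict_apply (hg y)

/-- The Markov property, given an event `R` determined by the chain up to time `p`. -/
lemma IsMarkovChain.measure_step (hX : IsMarkovChain T μ X) (p : ℕ) (R : (ℕ → V) → Prop)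
    (hR : ∀ x y, (∀ n ≤ p, x n = y n) → R x → R y) (l k : V) :
    μ {ω | (R (fun n => X n ω) ∧ X p ω = l) ∧ X (p + 1) ω = k} =
      μ {ω | R (fun n => X n ω) ∧ X p ω = l} * ENNReal.ofReal (T l k) := by
  have hg : ∀ y : Fin (p + 1) → V,
      MeasurableSet ((fun ω (n : Fin (p + 1)) => X n ω) ⁻¹' {y}) := fun y => by
    have : (fun ω (n : Fin (p + 1)) => X n ω) ⁻¹' {y} = ⋂ n : Fin (p + 1), X n ⁻¹' {y n} := by
      ext ω
      simp [funext_iff]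
    rw [this]
    exact MeasurableSet.iInter fun n => hX.measurable n (measurableSet_singleton _)
  rw [measure_eq_sum_inter_fiber hg, measure_eq_sum_inter_fiber hg, Finset.sum_mul]
  refine Finset.sum_congr rfl fun y _ => ?_
  -- The word `y` of length `p + 1`, continued by `k`.
  set x : ℕ → V := fun n => if h : n < p + 1 then y ⟨n, h⟩ else k with hxdef
  have hxk : x (p + 1) = k := by simp [hxdef]
  have hy : ∀ ω, (fun n : Fin (p + 1) => X n ω) = y ↔ ∀ n ≤ p, X n ω = x n := fun ω => by
    constructor
    · rintro rfl n hn
      have hn' : n < p + 1 := Nat.lt_succ_of_le hn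
      simp only [hxdef, dif_pos hn']
    · intro h
      funext n
      rw [h n (Nat.le_of_lt_succ n.2)]
      exact dif_pos n.2
  by_cases hx : R x ∧ x p = l
  · have h1 : (fun ω (n : Fin (p + 1)) => X n ω) ⁻¹' {y} ∩
        {ω | R (fun n => X n ω) ∧ X p ω = l} = {ω | ∀ n ≤ p, X n ω = x n} := by
      ext ω
      simp only [Set.mem_inter_iff, Set.mem_preimage, Set.mem_singleton_iff, Set.mem_ofPred_eq, hy]
      refine ⟨And.left, fun h => ⟨h, hR x _ (fun n hn => (h n hn).symm) hx.1, ?_⟩⟩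
      rw [h p le_rfl, hx.2]
    have h2 : (fun ω (n : Fin (p + 1)) => X n ω) ⁻¹' {y} ∩
        {ω | (R (fun n => X n ω) ∧ X p ω = l) ∧ X (p + 1) ω = k} =
          {ω | ∀ n ≤ p + 1, X n ω = x n} := by
      ext ω
      simp only [Set.mem_inter_iff, Set.mem_preimage, Set.mem_singleton_iff, Set.mem_ofPred_eq, hy]
      constructor
      · rintro ⟨h, -, hk⟩ n hn
        rcases Nat.le_succ_iff.1 hn with hn | rfl
        · exact h n hn
        · rw [hxk]; exact hk
      · intro h
        have h' : ∀ n ≤ p, X n ω = x n := fun n hn => h n (hn.trans p.le_succ)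
        refine ⟨h', ⟨hR x _ (fun n hn => (h' n hn).symm) hx.1, ?_⟩, ?_⟩
        · rw [h' p le_rfl, hx.2]
        · rw [h _ le_rfl, hxk]
    rw [h1, h2, hX.markov, hxk, hx.2]
  · have h1 : (fun ω (n : Fin (p + 1)) => X n ω) ⁻¹' {y} ∩
        {ω | R (fun n => X n ω) ∧ X p ω = l} = ∅ := by
      refine Set.eq_empty_of_forall_notMem fun ω hω => ?_
      obtain ⟨h, hRω, hl⟩ := hω
      have h' := (hy ω).1 h
      exact hx ⟨hR _ x h' hRω, by rw [← h' p le_rfl, hl]⟩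
    have h2 : (fun ω (n : Fin (p + 1)) => X n ω) ⁻¹' {y} ∩
        {ω | (R (fun n => X n ω) ∧ X p ω = l) ∧ X (p + 1) ω = k} = ∅ :=
      Set.subset_eq_empty (Set.inter_subset_inter_right _ fun ω hω => hω.1) h1
    rw [h1, h2, measure_empty, zero_mul]

variable [DecidableEq V]

/-- The probability to start in `i`, avoid `j` at the times `1, …, p` and be in `k` at time `p`. -/
lemma IsMarkovChain.measure_avoid (hX : IsMarkovChain T μ X) (hT : ∀ i j, 0 ≤ T i j)
    (i j : V) (p : ℕ) (k : V) :
    μ {ω | (X 0 ω = i ∧ ∀ n ∈ Set.Icc 1 p, X n ω ≠ j) ∧ X p ω = k} =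
      μ (X 0 ⁻¹' {i}) * ENNReal.ofReal ((taboo T j ^ p) i k) := by
  induction p generalizing k with
  | zero =>
    rw [pow_zero, Matrix.one_apply]
    split_ifs with hik
    · subst hik
      rw [ENNReal.ofReal_one, mul_one]
      congr 1
      ext ω
      simp +contextual
    · rw [ENNReal.ofReal_zero, mul_zero]
      convert measure_empty (μ := μ)
      refine Set.eq_empty_of_forall_notMem fun ω hω => hik ?_
      exact hω.1.1.symm.trans hω.2
  | succ p ih =>
    have hnn := pow_apply_nonneg (taboo_nonneg hT j)
    by_cases hk : k = j
    · have h0 : (taboo T j ^ (p + 1)) i k = 0 := by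
        simp [pow_succ, Matrix.mul_apply, taboo, hk]
      rw [h0, ENNReal.ofReal_zero, mul_zero]
      convert measure_empty (μ := μ)
      refine Set.eq_empty_of_forall_notMem fun ω hω => ?_
      exact hω.1.2 (p + 1) ⟨Nat.le_add_left 1 p, le_rfl⟩ (hω.2.trans hk)
    · rw [pow_succ, Matrix.mul_apply,
        ENNReal.ofReal_sum_of_nonneg fun l _ => mul_nonneg (hnn p i l) (taboo_nonneg hT j l k),
        Finset.mul_sum, measure_eq_sum_inter_fiber
          (fun l => hX.measurable p (measurableSet_singleton l))]
      refine Finset.sum_congr rfl fun l _ => ?_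
      have hset : X p ⁻¹' {l} ∩
          {ω | (X 0 ω = i ∧ ∀ n ∈ Set.Icc 1 (p + 1), X n ω ≠ j) ∧ X (p + 1) ω = k} =
          {ω | ((X 0 ω = i ∧ ∀ n ∈ Set.Icc 1 p, X n ω ≠ j) ∧ X p ω = l) ∧ X (p + 1) ω = k} := by
        ext ω
        simp only [Set.mem_inter_iff, Set.mem_preimage, Set.mem_singleton_iff, Set.mem_ofPred_eq]
        constructor
        · rintro ⟨hl, ⟨h0, h⟩, hk'⟩
          exact ⟨⟨⟨h0, fun n hn => h n ⟨hn.1, hn.2.trans p.le_succ⟩⟩, hl⟩, hk'⟩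
        · rintro ⟨⟨⟨h0, h⟩, hl⟩, hk'⟩
          refine ⟨hl, ⟨h0, fun n hn => ?_⟩, hk'⟩
          rcases Nat.le_succ_iff.1 hn.2 with hn' | rfl
          · exact h n ⟨hn.1, hn'⟩
          · rwa [Nat.succ_eq_add_one, hk']
      have hstep := hX.measure_step p (fun x => x 0 = i ∧ ∀ n ∈ Set.Icc 1 p, x n ≠ j)
        (fun x y hxy h => ⟨(hxy 0 p.zero_le).symm.trans h.1, fun n hn => by
          rw [← hxy n hn.2]; exact h.2 n hn⟩) l k
      rw [hset, hstep, ih, ENNReal.ofReal_mul (hnn p i l), mul_assoc]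
      simp [taboo, hk]

lemma IsMarkovChain.cond_lt_firstPassageTime [IsFiniteMeasure μ] (hX : IsMarkovChain T μ X)
    (hT : ∀ i j, 0 ≤ T i j) {i : V} (hi : μ (X 0 ⁻¹' {i}) ≠ 0) (j : V) (p : ℕ) :
    ProbabilityTheory.cond μ (X 0 ⁻¹' {i}) {ω | (p : ℕ∞) < firstPassageTime X j ω} =
      ENNReal.ofReal (∑ k, (taboo T j ^ p) i k) := by
  have hset : X 0 ⁻¹' {i} ∩ {ω | (p : ℕ∞) < firstPassageTime X j ω} =
      {ω | X 0 ω = i ∧ ∀ n ∈ Set.Icc 1 p, X n ω ≠ j} := by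
    ext ω
    simp [lt_firstPassageTime_iff]
  rw [cond_apply (hX.measurable 0 (measurableSet_singleton i)), hset,
    measure_eq_sum_inter_fiber (fun k => hX.measurable p (measurableSet_singleton k))
      {ω | X 0 ω = i ∧ ∀ n ∈ Set.Icc 1 p, X n ω ≠ j},
    ENNReal.ofReal_sum_of_nonneg fun k _ => pow_apply_nonneg (taboo_nonneg hT j) p i k]
  have : ∀ k, μ (X p ⁻¹' {k} ∩ {ω | X 0 ω = i ∧ ∀ n ∈ Set.Icc 1 p, X n ω ≠ j}) =
      μ (X 0 ⁻¹' {i}) * ENNReal.ofReal ((taboo T j ^ p) i k) := fun k => by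
    rw [← hX.measure_avoid hT, Set.inter_comm]
    rfl
  rw [Finset.sum_congr rfl fun k _ => this k, ← Finset.mul_sum, ← mul_assoc,
    ENNReal.inv_mul_cancel hi (measure_ne_top _ _), one_mul]

/-- The mean first passage time is the sum of the survival probabilities `Pr(F_j > p)`. -/
lemma IsMarkovChain.meanFirstPassageTime_eq_tsum [IsFiniteMeasure μ] (hX : IsMarkovChain T μ X)
    (hT : ∀ i j, 0 ≤ T i j) {i : V} (hi : μ (X 0 ⁻¹' {i}) ≠ 0) (j : V) :
    meanFirstPassageTime μ X i j = ∑' p, ENNReal.ofReal (∑ k, (taboo T j ^ p) i k) := by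
  have hmeas := hX.measurableSet_lt_firstPassageTime j
  have hind : ∀ p ω, (if (p : ℕ∞) < firstPassageTime X j ω then (1 : ℝ≥0∞) else 0) =
      {ω | (p : ℕ∞) < firstPassageTime X j ω}.indicator 1 ω := fun p ω => by
    simp [Set.indicator_apply]
  rw [meanFirstPassageTime]
  simp only [toENNReal_eq_tsum, hind]
  rw [lintegral_tsum fun p => (measurable_one.indicator (hmeas p)).aemeasurable]
  refine tsum_congr fun p => ?_
  rw [lintegral_indicator_one (hmeas p), hX.cond_lt_firstPassageTime hT hi]

/-- The nonnegative solution of the first-step equations is the mean first passage time. -/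
lemma IsMarkovChain.meanFirstPassageTime_eq [IsFiniteMeasure μ] (hX : IsMarkovChain T μ X)
    (hT : ∀ i j, 0 ≤ T i j) {i : V} (hi : μ (X 0 ⁻¹' {i}) ≠ 0) (j : V) {x : V → ℝ}
    (hx0 : ∀ i, 0 ≤ x i) (hx : x = 1 + (taboo T j).mulVec x) :
    meanFirstPassageTime μ X i j = ENNReal.ofReal (x i) := by
  have hsum := hasSum_pow_mulVec_one (taboo_nonneg hT j) hx0 hx i
  rw [hX.meanFirstPassageTime_eq_tsum hT hi, ← hsum.tsum_eq, ENNReal.ofReal_tsum_of_nonneg]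
  · exact fun p => Finset.sum_nonneg fun k _ => pow_apply_nonneg (taboo_nonneg hT j) p i k
  · exact hsum.summable

end Survival

end MFPT

theorem theorem1 {n : ℕ} (T : Matrix (Fin n) (Fin n) ℝ)
    (hT : T ∈ Matrix.rowStochastic ℝ (Fin n)) (hirr : T.IsIrreducible)
    {Ω : Type*} [MeasurableSpace Ω] (μ : MeasureTheory.Measure Ω)
    [MeasureTheory.IsProbabilityMeasure μ]
    (X : ℕ → Ω → Fin n) (hX : MFPT.IsMarkovChain T μ X)
    (i j : Fin n) (hi : μ (X 0 ⁻¹' {i}) ≠ 0) :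
    0 < MFPT.treeWeight T j ∧
    (i ≠ j → MFPT.meanFirstPassageTime μ X i j =
      ENNReal.ofReal (MFPT.forestWeight T i j / MFPT.treeWeight T j)) ∧
    (i = j → MFPT.meanFirstPassageTime μ X i j =
      ENNReal.ofReal (1 / MFPT.normalizedTreeWeight T j)) := by
  have hT0 : ∀ i k, 0 ≤ T i k := hirr.nonneg
  have hrow : ∀ i, ∑ k, T i k = 1 := Matrix.sum_row_of_mem_rowStochastic hT
  have hq := MFPT.treeWeight_pos hirr j
  -- By the first-step equations for the weights, this is `f_ij / q_j` if `i ≠ j`, and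
  -- `∑ r, q_r / q_j` if `i = j`.
  let x : Fin n → ℝ := fun i =>
    (MFPT.treeWeight T j + ∑ k, T i k * MFPT.forestWeight T k j) / MFPT.treeWeight T j
  have hx0 : ∀ i, 0 ≤ x i := fun i =>
    div_nonneg (add_nonneg hq.le (Finset.sum_nonneg fun k _ =>
      mul_nonneg (hT0 i k) (MFPT.forestWeight_nonneg hT0 k j))) hq.le
  have hxf : ∀ k, k ≠ j → x k = MFPT.forestWeight T k j / MFPT.treeWeight T j := fun k hk => by
    rw [MFPT.forestWeight_first_step (hrow k) hk]
  have hx : x = 1 + (MFPT.taboo T j).mulVec x := by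
    funext i
    have hsum : (MFPT.taboo T j).mulVec x i =
        (∑ k, T i k * MFPT.forestWeight T k j) / MFPT.treeWeight T j := by
      rw [Matrix.mulVec, dotProduct, Finset.sum_div]
      refine Finset.sum_congr rfl fun k _ => ?_
      by_cases hk : k = j
      · simp [MFPT.taboo, hk, MFPT.forestWeight_self]
      · rw [hxf k hk]
        simp [MFPT.taboo, hk, mul_div_assoc]
    rw [Pi.add_apply, Pi.one_apply, hsum]
    simp only [x]
    rw [add_div, div_self hq.ne']
  have hm := hX.meanFirstPassageTime_eq hT0 hi j hx0 hx
  refine ⟨hq, fun hij => ?_, fun hij => ?_⟩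
  · rw [hm, hxf i hij]
  · subst hij
    rw [hm, MFPT.normalizedTreeWeight, one_div_div, MFPT.sum_treeWeight_first_step T i]
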